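/- Let $G$ be a locally compact $\sigma$-compact group with left Haar measure $m$. A (left) Følner sequence is a sequence $\mathcal F=(F_n)_{n\in\mathbb N}$ of non-empty compact subsets of $G$ (of positive Haar measure for all large $n$) with $\lim_{n\to\infty} m(gF_n\triangle F_n)/m(F_n)=0$ for every $g\in G$. Assume that $G$ is amenable, i.e. that a Følner sequence exists. Let $(X,d)$ be a compact metric space on which $G$ acts continuously, i.e. $(g,x)\mapsto gx$ is a continuous map $G\times X\to X$. For $x,y\in X$ put \[ D_{\mathcal F}(x,y)=\limsup_{n\to\infty}\frac1{m(F_n)}\int_{F_n} d(tx,ty)\,dm(t),\qquad D(x,y)=\sup\{D_{\mathcal F}(x,y) : \mathcal F \text{ is a Følner sequence}\}. \] The system $(X,G)$ is called mean equicontinuous if for every $\varepsilon>0$ there is $\delta>0$ such that $D(x,y)<\varepsilon$ for all $x,y\in X$ with $d(x,y)<\delta$. A system $(Y,G)$ is called pointwise uniquely ergodic if for every $y\in Y$ there is exactly one $G$-invariant Borel probability measure $\mu_y$ on $Y$ that is supported on the orbit closure $\overline{Gy}$. Then $(X,G)$ is mean equicontinuous if and only if the following two conditions hold: \begin{itemize}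 \item the product system $(X\times X,G)$, with the diagonal action $g(x,y)=(gx,gy)$, is pointwise uniquely ergodic; \item the map $(x,y)\mapsto\mu_{(x,y)}$ from $X\times X$ to the Borel probability measures on $X\times X$ is continuous with respect to the weak-* topology. \end{itemize} -/

import Mathlib

open MeasureTheory Filter Topology

noncomputable section

namespace MeanEquicontinuity

section Folner

variable {G : Type*} [Group G] [TopologicalSpace G] [MeasurableSpace G]

/-- A (left) Følner sequence with respect to the (left Haar) measure `m`: non-empty compact sets
`F n` such that `m (g F n ∆ F n) / m (F n)` tends to `0` for every `g`. That the quotients make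
sense (the `F n` are eventually measurable, of positive finite measure) is part of Mathlib's
`IsFoelner`. -/
structure IsFolnerSequence (m : Measure G) (F : ℕ → Set G) : Prop where
  nonempty : ∀ n, (F n).Nonempty
  isCompact : ∀ n, IsCompact (F n)
  isFoelner : IsFoelner G m atTop F

/-- Amenability of a locally compact `σ`-compact group with left Haar measure `m`:
there is a Følner sequence. -/
def IsAmenable (m : Measure G) : Prop :=
  ∃ F : ℕ → Set G, IsFolnerSequence m F

variable {X : Type*} [MetricSpace X] [MulAction G X]

/-- `D_F (x, y)`, the upper limit of the averages of `d (t x, t y)` over `t ∈ F n`. -/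
def besicovitchDist (m : Measure G) (F : ℕ → Set G) (x y : X) : ℝ :=
  limsup (fun n : ℕ => ⨍ t in F n, dist (t • x) (t • y) ∂m) atTop

/-- `D (x, y)`, the supremum of `D_F (x, y)` over all Følner sequences `F`. -/
def weylDist (m : Measure G) (x y : X) : ℝ :=
  sSup {r : ℝ | ∃ F : ℕ → Set G, IsFolnerSequence m F ∧ r = besicovitchDist m F x y}

/-- (Weyl-)mean equicontinuity of the action of `G` on `X`. -/
def IsMeanEquicontinuous (X : Type*) [MetricSpace X] [MulAction G X] (m : Measure G) : Prop :=
  ∀ ε : ℝ, 0 < ε → ∃ δ : ℝ, 0 < δ ∧ ∀ x y : X, dist x y < δ → weylDist m x y < ε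

end Folner

section Ergodic

variable (G : Type*) [Group G] {Y : Type*} [TopologicalSpace Y] [MeasurableSpace Y] [MulAction G Y]

/-- The orbit closure of `y`. -/
def orbitClosure (y : Y) : Set Y := closure (MulAction.orbit G y)

/-- `μ` is a `G`-invariant Borel probability measure on the closed invariant set `A`, viewed as a
measure on the ambient space that is carried by `A`. -/
structure IsInvariantOn (A : Set Y) (μ : ProbabilityMeasure Y) : Prop where
  invariant : SMulInvariantMeasure G Y (μ : Measure Y)
  carried : (μ : Measure Y) A = 1

/-- The closed invariant set `A` is uniquely ergodic: it carries exactly one invariant Borel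
probability measure. -/
def IsUniquelyErgodic (A : Set Y) : Prop :=
  ∃! μ : ProbabilityMeasure Y, IsInvariantOn G A μ

variable (Y) in
/-- Every orbit closure is uniquely ergodic. -/
def IsPointwiseUniquelyErgodic : Prop :=
  ∀ y : Y, IsUniquelyErgodic G (orbitClosure G y)

variable {G} in
/-- The map `y ↦ μ_y`, where `μ_y` is the unique invariant Borel probability measure on the orbit
closure of `y`. -/
def orbitMeasure (h : IsPointwiseUniquelyErgodic G Y) (y : Y) : ProbabilityMeasure Y :=
  (h y).exists.choose

end Ergodic

end MeanEquicontinuity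

end

/-! Mean equicontinuity says that the Weyl pseudometric D is continuous, and it passes to `X × X`,
so the forward direction can be proved for a single system `Z`. Let ν₁, ν₂ be invariant measures on
one orbit closure. D is G-invariant (`weylDist_smul_smul`), hence so is the continuous kernel Φ =
max (r - D) 0. Its partial integrals are constant on the orbit closure, so Φ · (ν₁ × ν₂), once
normalised, is an invariant coupling of ν₁ and ν₂ that lives where D < r. For an invariant coupling
the mean of d equals the mean of its Følner averages, hence is at most r (`integral_dist_mul_le`).
Letting r → 0 gives ν₁ = ν₂. Continuity of the measures follows since their integrals differ by at
most ε + C · D (`abs_integral_orbitMeasure_sub_le`). Conversely, unique ergodicity on `X × X` makes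
D(x, y) the integral of d against μ_(x,y) (`weylDist_eq_integral_dist`). So D is continuous, and it
vanishes on the diagonal. -/

noncomputable section

namespace MeanEquicontinuity

open scoped symmDiff Pointwise

/-! ### Normalised averages over a set -/

section Averages

variable {G : Type*} [MeasurableSpace G]

/-- The normalised restriction of `m` to `A`. -/
def avgMeasure (m : Measure G) (A : Set G) : Measure G := (m A)⁻¹ • m.restrict A

theorem setAverage_eq_integral_avgMeasure (m : Measure G) (A : Set G) (φ : G → ℝ) :
    ⨍ t in A, φ t ∂m = ∫ t, φ t ∂avgMeasure m A :=
  setAverage_eq' m φ A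

theorem isProbabilityMeasure_avgMeasure {m : Measure G} {A : Set G} (h0 : m A ≠ 0)
    (htop : m A ≠ ⊤) : IsProbabilityMeasure (avgMeasure m A) :=
  ⟨by simp [avgMeasure, ENNReal.inv_mul_cancel h0 htop]⟩

/-- When `m A` is `0` or `⊤` the normalised restriction is the zero measure, so bounds on averages
need no condition on `A`. -/
theorem avgMeasure_real_univ_le_one {m : Measure G} {A : Set G} :
    (avgMeasure m A).real Set.univ ≤ 1 := by
  refine ENNReal.toReal_le_of_le_ofReal zero_le_one ?_
  simp [avgMeasure, ENNReal.inv_mul_le_one]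

instance isFiniteMeasure_avgMeasure {m : Measure G} {A : Set G} :
    IsFiniteMeasure (avgMeasure m A) :=
  ⟨lt_of_le_of_lt (by simp [avgMeasure, ENNReal.inv_mul_le_one]) ENNReal.one_lt_top⟩

theorem abs_setAverage_le {m : Measure G} {A : Set G} {φ : G → ℝ} {M : ℝ} (hM : 0 ≤ M)
    (hφ : ∀ t, |φ t| ≤ M) : |⨍ t in A, φ t ∂m| ≤ M := by
  rw [setAverage_eq_integral_avgMeasure, ← Real.norm_eq_abs]
  refine (norm_integral_le_of_norm_le_const (Eventually.of_forall hφ)).trans ?_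
  exact mul_le_of_le_one_right hM avgMeasure_real_univ_le_one

/-- The contributions of `A ∩ B` cancel. -/
theorem abs_setIntegral_sub_setIntegral_le {m : Measure G} {A B : Set G} (hA : MeasurableSet A)
    (hB : MeasurableSet B) (hmA : m A ≠ ⊤) (hmB : m B ≠ ⊤) {φ : G → ℝ} {M : ℝ}
    (hmeas : StronglyMeasurable φ) (hφ : ∀ t, |φ t| ≤ M) :
    |∫ t in A, φ t ∂m - ∫ t in B, φ t ∂m| ≤ M * m.real (A ∆ B) := by
  have hint : ∀ C : Set G, m C ≠ ⊤ → IntegrableOn φ C m := fun C hC =>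
    Measure.integrableOn_of_bounded hC hmeas.aestronglyMeasurable (Eventually.of_forall hφ)
  have hbd : ∀ C : Set G, m C ≠ ⊤ → |∫ t in C, φ t ∂m| ≤ M * m.real C := fun C hC =>
    norm_setIntegral_le_of_norm_le_const (f := φ) hC.lt_top fun t _ => hφ t
  have hAB : m (A \ B) ≠ ⊤ := measure_ne_top_of_subset Set.sdiff_subset hmA
  have hBA : m (B \ A) ≠ ⊤ := measure_ne_top_of_subset Set.sdiff_subset hmB
  have h1 := integral_inter_add_sdiff hB (hint A hmA)
  have h2 := integral_inter_add_sdiff hA (hint B hmB)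
  rw [Set.inter_comm] at h2
  have h3 : m.real (A ∆ B) = m.real (A \ B) + m.real (B \ A) := by
    rw [Measure.real, measure_symmDiff_eq hA.nullMeasurableSet hB.nullMeasurableSet,
      ENNReal.toReal_add hAB hBA]
    rfl
  rw [← h1, ← h2, h3, add_sub_add_left_eq_sub, mul_add]
  exact (abs_sub _ _).trans (add_le_add (hbd _ hAB) (hbd _ hBA))

end Averages

/-! ### Følner sequences under left and right translation -/

section Folner

theorem IsFolnerSequence.eventually_isProbabilityMeasure {G : Type*} [Group G]
    [TopologicalSpace G] [MeasurableSpace G] {m : Measure G} {F : ℕ → Set G}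
    (hF : IsFolnerSequence m F) :
    ∀ᶠ n in atTop, IsProbabilityMeasure (avgMeasure m (F n)) := by
  filter_upwards [hF.isFoelner.eventually_meas_ne_zero, hF.isFoelner.eventually_meas_ne_top]
    with n h0 htop using isProbabilityMeasure_avgMeasure h0 htop

variable {G : Type*} [Group G] [TopologicalSpace G] [IsTopologicalGroup G]
  [MeasurableSpace G] [BorelSpace G] {m : Measure G} [m.IsHaarMeasure] {F : ℕ → Set G}

/-- Averages along a Følner sequence are asymptotically invariant under left translation. -/
theorem IsFolnerSequence.tendsto_setAverage_translate_sub (hF : IsFolnerSequence m F) {φ : G → ℝ}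
    {M : ℝ} (hmeas : StronglyMeasurable φ) (hφ : ∀ t, |φ t| ≤ M) (g : G) :
    Tendsto (fun n => ⨍ t in F n, φ (g * t) ∂m - ⨍ t in F n, φ t ∂m) atTop (𝓝 0) := by
  have hlim : Tendsto (fun n => M * (m ((g • F n) ∆ F n) / m (F n)).toReal) atTop (𝓝 0) := by
    have := (ENNReal.tendsto_toReal ENNReal.zero_ne_top).comp
      (hF.isFoelner.tendsto_meas_smul_symmDiff g)
    simpa using this.const_mul M
  refine squeeze_zero_norm' ?_ hlim
  filter_upwards [hF.isFoelner.eventually_measurableSet, hF.isFoelner.eventually_meas_ne_zero,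
    hF.isFoelner.eventually_meas_ne_top] with n hn h0 htop
  have htrans : ∫ t in F n, φ (g * t) ∂m = ∫ t in g • F n, φ t ∂m := by
    rw [← (measurePreserving_mul_left m g).setIntegral_preimage_emb
      (Homeomorph.mulLeft g).measurableEmbedding φ (g • F n)]
    congr 2
    ext t
    simp [Set.mem_smul_set_iff_inv_smul_mem]
  have hg : MeasurableSet (g • F n) := hn.const_smul g
  have hgtop : m (g • F n) ≠ ⊤ := by rwa [measure_smul]
  rw [setAverage_eq, setAverage_eq, htrans, ← smul_sub, norm_smul, norm_inv, Real.norm_eq_abs,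
    Real.norm_eq_abs, abs_of_nonneg measureReal_nonneg, ENNReal.toReal_div]
  calc (m.real (F n))⁻¹ * |∫ t in g • F n, φ t ∂m - ∫ t in F n, φ t ∂m|
      ≤ (m.real (F n))⁻¹ * (M * m.real ((g • F n) ∆ F n)) := by
        gcongr
        exact abs_setIntegral_sub_setIntegral_le hg hn hgtop htop hmeas hφ
    _ = _ := by simp only [Measure.real]; ring

variable [LocallyCompactSpace G] [SigmaCompactSpace G] [m.Regular]

theorem measure_preimage_mul_right (m : Measure G) [m.IsHaarMeasure] [m.Regular] (k : G)
    {A : Set G} (hA : MeasurableSet A) :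
    m ((· * k) ⁻¹' A) = Measure.modularCharacterFun k * m A := by
  have h := congrArg (fun ν => ν A) (Measure.map_right_mul_eq_modularCharacterFun_smul m k)
  rw [Measure.map_apply (measurable_mul_const k) hA] at h
  simpa using h

/-- A right translate of a left Følner sequence is a left Følner sequence. -/
theorem IsFolnerSequence.preimage_mul_right (hF : IsFolnerSequence m F) (k : G) :
    IsFolnerSequence m (fun n => (· * k) ⁻¹' F n) where
  nonempty n := (hF.nonempty n).preimage (mul_right_surjective k)
  isCompact n := (Homeomorph.mulRight k).isCompact_preimage.2 (hF.isCompact n)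
  isFoelner := by
    have hc0 : (Measure.modularCharacterFun k : ENNReal) ≠ 0 := by
      exact_mod_cast (Measure.modularCharacterFun_pos k).ne'
    have hct : (Measure.modularCharacterFun k : ENNReal) ≠ ⊤ := ENNReal.coe_ne_top
    refine ⟨?_, ?_, ?_, fun g => ?_⟩
    · filter_upwards [hF.isFoelner.eventually_measurableSet] with n hn
      exact measurable_mul_const k hn
    · filter_upwards [hF.isFoelner.eventually_measurableSet,
        hF.isFoelner.eventually_meas_ne_zero] with n hn h0
      rw [measure_preimage_mul_right m k hn]
      exact mul_ne_zero hc0 h0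
    · filter_upwards [hF.isFoelner.eventually_measurableSet,
        hF.isFoelner.eventually_meas_ne_top] with n hn htop
      rw [measure_preimage_mul_right m k hn]
      exact ENNReal.mul_ne_top hct htop
    · refine (hF.isFoelner.tendsto_meas_smul_symmDiff g).congr' ?_
      filter_upwards [hF.isFoelner.eventually_measurableSet] with n hn
      -- Left and right translations commute, so the modular factor of `k` appears in numerator and
      -- denominator and cancels.
      have hset : (g • ((· * k) ⁻¹' F n)) ∆ ((· * k) ⁻¹' F n) =
          (· * k) ⁻¹' ((g • F n) ∆ F n) := by
        ext t
        simp [Set.mem_symmDiff, Set.mem_smul_set_iff_inv_smul_mem, mul_assoc]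
      rw [hset, measure_preimage_mul_right m k ((hn.const_smul g).symmDiff hn),
        measure_preimage_mul_right m k hn, ENNReal.mul_div_mul_left _ _ hc0 hct]

theorem setAverage_preimage_mul_right (m : Measure G) [m.IsHaarMeasure] [m.Regular] (k : G)
    {A : Set G} (hA : MeasurableSet A) (φ : G → ℝ) :
    ⨍ t in (· * k) ⁻¹' A, φ (t * k) ∂m = ⨍ t in A, φ t ∂m := by
  have hc0 : (Measure.modularCharacterFun k : ℝ) ≠ 0 := by
    exact_mod_cast (Measure.modularCharacterFun_pos k).ne'
  have hmap := (Homeomorph.mulRight k).measurableEmbedding.setIntegral_map (μ := m) φ A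
  have hmap' : ∫ t in (· * k) ⁻¹' A, φ (t * k) ∂m =
      Measure.modularCharacterFun k * ∫ t in A, φ t ∂m := by
    have h := Measure.map_right_mul_eq_modularCharacterFun_smul m k
    simp only [Homeomorph.coe_mulRight] at hmap
    rw [← hmap, h, Measure.restrict_smul, integral_smul_nnreal_measure]
    rfl
  rw [setAverage_eq, setAverage_eq, hmap', Measure.real, measure_preimage_mul_right m k hA,
    ENNReal.toReal_mul, smul_eq_mul, smul_eq_mul, ENNReal.coe_toReal, Measure.real]
  field_simp

end Folner

/-! ### Averages along orbits and the Weyl pseudometric -/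

section OrbitAverages

variable {G : Type*} [Group G] [TopologicalSpace G] [MeasurableSpace G] [BorelSpace G]
  {Z : Type*} [MetricSpace Z] [CompactSpace Z] [MulAction G Z] [ContinuousSMul G Z]
  {m : Measure G} {F : ℕ → Set G}

theorem exists_abs_le_of_continuous {f : Z → ℝ} (hf : Continuous f) :
    ∃ M : ℝ, 0 ≤ M ∧ ∀ z, |f z| ≤ M := by
  obtain ⟨M, hM⟩ := isCompact_univ.exists_bound_of_continuousOn hf.continuousOn
  exact ⟨|M|, abs_nonneg M, fun z => (hM z trivial).trans (le_abs_self M)⟩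

/-- A continuous function on a compact metric space is Lipschitz up to an additive error. -/
theorem exists_abs_sub_le_add_mul_dist {f : Z → ℝ} (hf : Continuous f) {ε : ℝ} (hε : 0 < ε) :
    ∃ C : ℝ, 0 ≤ C ∧ ∀ a b, |f a - f b| ≤ ε + C * dist a b := by
  obtain ⟨M, hM0, hM⟩ := exists_abs_le_of_continuous hf
  obtain ⟨δ, hδ, hfδ⟩ :=
    Metric.uniformContinuous_iff.1 (CompactSpace.uniformContinuous_of_continuous hf) ε hε
  -- At distance at least `δ` the trivial bound `2 * M` is absorbed by the linear term; below `δ`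
  -- uniform continuity suffices.
  refine ⟨2 * M / δ, by positivity, fun a b => ?_⟩
  rcases lt_or_ge (dist a b) δ with h | h
  · have h1 := hfδ h
    rw [Real.dist_eq] at h1
    have : 0 ≤ 2 * M / δ * dist a b := by positivity
    linarith
  · have h1 : |f a - f b| ≤ 2 * M := (abs_sub _ _).trans (by linarith [hM a, hM b])
    have h2 : 2 * M ≤ 2 * M / δ * dist a b := by
      rw [div_mul_eq_mul_div, le_div_iff₀ hδ]
      gcongr
    linarith

omit [CompactSpace Z] in
theorem stronglyMeasurable_orbit {f : Z → ℝ} (hf : Continuous f) (z : Z) :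
    StronglyMeasurable (fun t : G => f (t • z)) :=
  (hf.comp (continuous_id.smul continuous_const)).stronglyMeasurable

omit [CompactSpace Z] in
theorem stronglyMeasurable_dist_smul (x y : Z) :
    StronglyMeasurable (fun t : G => dist (t • x) (t • y)) :=
  ((continuous_id.smul continuous_const).dist
    (continuous_id.smul continuous_const)).stronglyMeasurable

theorem integrable_orbit {f : Z → ℝ} (hf : Continuous f) (z : Z) (ν : Measure G)
    [IsFiniteMeasure ν] : Integrable (fun t : G => f (t • z)) ν := by
  obtain ⟨M, -, hM⟩ := exists_abs_le_of_continuous hf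
  exact Integrable.of_bound (stronglyMeasurable_orbit hf z).aestronglyMeasurable M
    (Eventually.of_forall fun t => hM _)

theorem dist_le_diam_univ (x y : Z) : dist x y ≤ Metric.diam (Set.univ : Set Z) :=
  Metric.dist_le_diam_of_mem isCompact_univ.isBounded trivial trivial

theorem integrable_dist_smul (x y : Z) (ν : Measure G) [IsFiniteMeasure ν] :
    Integrable (fun t : G => dist (t • x) (t • y)) ν :=
  Integrable.of_bound (stronglyMeasurable_dist_smul x y).aestronglyMeasurable
    (Metric.diam (Set.univ : Set Z)) (Eventually.of_forall fun t => by
      rw [Real.norm_eq_abs, abs_of_nonneg dist_nonneg]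
      exact dist_le_diam_univ _ _)

omit [TopologicalSpace G] [BorelSpace G] [ContinuousSMul G Z] in
theorem setAverage_dist_smul_mem_Icc (A : Set G) (x y : Z) :
    ⨍ t in A, dist (t • x) (t • y) ∂m ∈ Set.Icc 0 (Metric.diam (Set.univ : Set Z)) := by
  refine ⟨?_, (abs_le.1 (abs_setAverage_le Metric.diam_nonneg fun t => ?_)).2⟩
  · rw [setAverage_eq_integral_avgMeasure]
    exact integral_nonneg fun t => dist_nonneg
  · rw [abs_of_nonneg dist_nonneg]
    exact dist_le_diam_univ _ _

omit [TopologicalSpace G] [BorelSpace G] [ContinuousSMul G Z] in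
theorem isBoundedUnder_le_setAverage_dist (F : ℕ → Set G) (x y : Z) :
    IsBoundedUnder (· ≤ ·) atTop (fun n => ⨍ t in F n, dist (t • x) (t • y) ∂m) :=
  isBoundedUnder_of ⟨_, fun n => (setAverage_dist_smul_mem_Icc (F n) x y).2⟩

omit [TopologicalSpace G] [BorelSpace G] [ContinuousSMul G Z] in
theorem isBoundedUnder_ge_setAverage_dist (F : ℕ → Set G) (x y : Z) :
    IsBoundedUnder (· ≥ ·) atTop (fun n => ⨍ t in F n, dist (t • x) (t • y) ∂m) :=
  isBoundedUnder_of ⟨_, fun n => (setAverage_dist_smul_mem_Icc (F n) x y).1⟩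

omit [BorelSpace G] [ContinuousSMul G Z] in
-- The diameter bounds the set under the real `sSup`, which would otherwise take its default value.
theorem besicovitchDist_le_weylDist (hF : IsFolnerSequence m F) (x y : Z) :
    besicovitchDist m F x y ≤ weylDist m x y := by
  refine le_csSup ⟨Metric.diam (Set.univ : Set Z), ?_⟩ ⟨F, hF, rfl⟩
  rintro _ ⟨F', -, rfl⟩
  exact limsup_le_of_le (isBoundedUnder_ge_setAverage_dist F' x y).isCoboundedUnder_le
    (Eventually.of_forall fun n => (setAverage_dist_smul_mem_Icc (F' n) x y).2)

omit [BorelSpace G] [ContinuousSMul G Z] [CompactSpace Z] in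
-- Amenability makes the set under the supremum non-empty; `r` may have any sign.
theorem weylDist_le (hG : IsAmenable m) {x y : Z} {r : ℝ}
    (h : ∀ F, IsFolnerSequence m F → besicovitchDist m F x y ≤ r) : weylDist m x y ≤ r := by
  obtain ⟨F, hF⟩ := hG
  refine csSup_le ⟨_, F, hF, rfl⟩ ?_
  rintro _ ⟨F', hF', rfl⟩
  exact h F' hF'

omit [BorelSpace G] [ContinuousSMul G Z] in
theorem eventually_setAverage_dist_lt (hF : IsFolnerSequence m F) {x y : Z} {r : ℝ}
    (h : weylDist m x y < r) : ∀ᶠ n in atTop, ⨍ t in F n, dist (t • x) (t • y) ∂m < r :=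
  eventually_lt_of_limsup_lt ((besicovitchDist_le_weylDist hF x y).trans_lt h)
    (isBoundedUnder_le_setAverage_dist F x y)

omit [BorelSpace G] [ContinuousSMul G Z] in
theorem weylDist_nonneg (hG : IsAmenable m) (x y : Z) : 0 ≤ weylDist m x y := by
  obtain ⟨F, hF⟩ := hG
  refine le_trans ?_ (besicovitchDist_le_weylDist hF x y)
  exact le_limsup_of_frequently_le
    (Frequently.of_forall fun n => (setAverage_dist_smul_mem_Icc (F n) x y).1)
    (isBoundedUnder_le_setAverage_dist F x y)

omit [BorelSpace G] [ContinuousSMul G Z] [CompactSpace Z] in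
theorem weylDist_comm (x y : Z) : weylDist m x y = weylDist m y x := by
  simp only [weylDist, besicovitchDist, dist_comm]

omit [BorelSpace G] [ContinuousSMul G Z] [CompactSpace Z] in
theorem weylDist_self (hG : IsAmenable m) (x : Z) : weylDist m x x = 0 := by
  obtain ⟨F, hF⟩ := hG
  have : {r : ℝ | ∃ F : ℕ → Set G, IsFolnerSequence m F ∧ r = besicovitchDist m F x x} = {0} := by
    ext r
    simp only [besicovitchDist, dist_self, setAverage_eq, integral_zero, smul_zero,
      limsup_const, Set.mem_ofPred_eq, Set.mem_singleton_iff]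
    exact ⟨fun ⟨_, _, h⟩ => h, fun h => ⟨F, hF, h⟩⟩
  rw [weylDist, this, csSup_singleton]

/-- A bound between distance functions passes to the Weyl pseudometrics. -/
theorem weylDist_le_add {Z₁ Z₂ : Type*} [MetricSpace Z₁] [CompactSpace Z₁] [MulAction G Z₁]
    [ContinuousSMul G Z₁] [MetricSpace Z₂] [CompactSpace Z₂] [MulAction G Z₂]
    [ContinuousSMul G Z₂] (hG : IsAmenable m) {x y : Z} {x₁ y₁ : Z₁} {x₂ y₂ : Z₂}
    (h : ∀ t : G, dist (t • x) (t • y) ≤ dist (t • x₁) (t • y₁) + dist (t • x₂) (t • y₂)) :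
    weylDist m x y ≤ weylDist m x₁ y₁ + weylDist m x₂ y₂ := by
  refine weylDist_le hG fun F hF => le_of_forall_pos_le_add fun ε hε => ?_
  refine limsup_le_of_le (isBoundedUnder_ge_setAverage_dist F x y).isCoboundedUnder_le ?_
  filter_upwards [eventually_setAverage_dist_lt hF
      (show weylDist m x₁ y₁ < weylDist m x₁ y₁ + ε / 2 by linarith),
    eventually_setAverage_dist_lt hF
      (show weylDist m x₂ y₂ < weylDist m x₂ y₂ + ε / 2 by linarith)] with n h₁ h₂
  have hle : ⨍ t in F n, dist (t • x) (t • y) ∂m ≤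
      ⨍ t in F n, dist (t • x₁) (t • y₁) ∂m + ⨍ t in F n, dist (t • x₂) (t • y₂) ∂m := by
    simp only [setAverage_eq_integral_avgMeasure]
    rw [← integral_add (integrable_dist_smul _ _ _) (integrable_dist_smul _ _ _)]
    exact integral_mono (integrable_dist_smul _ _ _)
      ((integrable_dist_smul _ _ _).add (integrable_dist_smul _ _ _)) h
  linarith

theorem weylDist_triangle (hG : IsAmenable m) (x y z : Z) :
    weylDist m x z ≤ weylDist m x y + weylDist m y z :=
  weylDist_le_add hG fun _ => dist_triangle _ _ _

theorem abs_weylDist_sub_le (hG : IsAmenable m) (x y x' y' : Z) :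
    |weylDist m x y - weylDist m x' y'| ≤ weylDist m x x' + weylDist m y y' := by
  have h₁ := weylDist_triangle hG x x' y
  have h₂ := weylDist_triangle hG x' y' y
  have h₃ := weylDist_triangle hG x' x y'
  have h₄ := weylDist_triangle hG x y y'
  rw [weylDist_comm y' y] at h₂
  rw [weylDist_comm x' x] at h₃
  exact abs_le.2 ⟨by linarith, by linarith⟩

theorem IsMeanEquicontinuous.continuous_weylDist (hG : IsAmenable m)
    (h : IsMeanEquicontinuous Z m) : Continuous fun p : Z × Z => weylDist m p.1 p.2 := by
  refine Metric.continuous_iff.2 fun p ε hε => ?_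
  obtain ⟨δ, hδ, hδ'⟩ := h (ε / 2) (by linarith)
  refine ⟨δ, hδ, fun q hq => ?_⟩
  rw [Prod.dist_eq, max_lt_iff] at hq
  have := abs_weylDist_sub_le hG q.1 q.2 p.1 p.2
  rw [Real.dist_eq]
  linarith [hδ' _ _ hq.1, hδ' _ _ hq.2]

theorem IsMeanEquicontinuous.prod (hG : IsAmenable m) (h : IsMeanEquicontinuous Z m) :
    IsMeanEquicontinuous (Z × Z) m := by
  intro ε hε
  obtain ⟨δ, hδ, hδ'⟩ := h (ε / 2) (by linarith)
  refine ⟨δ, hδ, fun p q hpq => ?_⟩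
  rw [Prod.dist_eq, max_lt_iff] at hpq
  have hle : weylDist m p q ≤ weylDist m p.1 q.1 + weylDist m p.2 q.2 :=
    weylDist_le_add hG fun t => by
      rw [Prod.dist_eq]
      exact max_le_add_of_nonneg dist_nonneg dist_nonneg
  linarith [hδ' _ _ hpq.1, hδ' _ _ hpq.2]

omit [ContinuousSMul G Z] in
-- Averaging at `g • x`, `g • y` along `F n` is averaging at `x`, `y` along the right translate of
-- `F n` by `g`, again a Følner sequence. The supremum over all Følner sequences absorbs this
-- change.
theorem weylDist_smul_smul_le [IsTopologicalGroup G] [LocallyCompactSpace G] [SigmaCompactSpace G]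
    [m.IsHaarMeasure] [m.Regular] (hG : IsAmenable m) (g : G) (x y : Z) :
    weylDist m (g • x) (g • y) ≤ weylDist m x y := by
  refine weylDist_le hG fun F hF => ?_
  refine le_of_eq_of_le (limsup_congr ?_)
    (besicovitchDist_le_weylDist (hF.preimage_mul_right g⁻¹) x y)
  filter_upwards [hF.isFoelner.eventually_measurableSet] with n hn
  rw [← setAverage_preimage_mul_right m g⁻¹ hn]
  simp [smul_smul]

omit [ContinuousSMul G Z] in
theorem weylDist_smul_smul [IsTopologicalGroup G] [LocallyCompactSpace G] [SigmaCompactSpace G]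
    [m.IsHaarMeasure] [m.Regular] (hG : IsAmenable m) (g : G) (x y : Z) :
    weylDist m (g • x) (g • y) = weylDist m x y := by
  refine le_antisymm (weylDist_smul_smul_le hG g x y) ?_
  simpa using weylDist_smul_smul_le hG g⁻¹ (g • x) (g • y)

end OrbitAverages

/-! ### Empirical measures and their limits -/

section Empirical

variable {G : Type*} [Group G] [TopologicalSpace G] [IsTopologicalGroup G] [MeasurableSpace G]
  [BorelSpace G] {Z : Type*} [MetricSpace Z] [CompactSpace Z] [MeasurableSpace Z] [BorelSpace Z]
  [MulAction G Z] [ContinuousSMul G Z] {m : Measure G} [m.IsHaarMeasure] {F : ℕ → Set G}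

omit [MeasurableSpace G] [BorelSpace G] [IsTopologicalGroup G] [CompactSpace Z] in
theorem measurable_smul_const_left (g : G) : Measurable fun z : Z => g • z :=
  (continuous_const_smul g).measurable

omit [MeasurableSpace G] [BorelSpace G] [IsTopologicalGroup G] [CompactSpace Z] in
theorem smulInvariantMeasure_of_integral_eq {μ : Measure Z} [IsFiniteMeasure μ]
    (h : ∀ (g : G) (f : Z → ℝ), Continuous f → ∫ z, f (g • z) ∂μ = ∫ z, f z ∂μ) :
    SMulInvariantMeasure G Z μ where
  measure_preimage_smul g s hs := by
    have hmap : μ.map (fun z => g • z) = μ :=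
      ext_of_forall_integral_eq_of_IsFiniteMeasure fun f => by
        rw [integral_map (measurable_smul_const_left g).aemeasurable
          f.continuous.aestronglyMeasurable]
        exact h g f f.continuous
    rw [← Measure.map_apply (measurable_smul_const_left g) hs, hmap]

omit [MeasurableSpace G] [BorelSpace G] [IsTopologicalGroup G] [CompactSpace Z] in
theorem integral_smul_eq_of_smulInvariant {μ : Measure Z} [SMulInvariantMeasure G Z μ] (g : G)
    (f : Z → ℝ) : ∫ z, f (g • z) ∂μ = ∫ z, f z ∂μ :=
  (measurePreserving_smul g μ).integral_comp
    (Homeomorph.smul g).measurableEmbedding f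

/-- Every ultrafilter limit of the empirical measures of `z` along a Følner sequence is an
invariant probability measure on the orbit closure of `z`. -/
theorem IsFolnerSequence.exists_tendsto_setAverage (hF : IsFolnerSequence m F) (z : Z)
    (U : Ultrafilter ℕ) (hU : (U : Filter ℕ) ≤ atTop) :
    ∃ μ : ProbabilityMeasure Z, IsInvariantOn G (orbitClosure G z) μ ∧
      ∀ f : Z → ℝ, Continuous f →
        Tendsto (fun n => ⨍ t in F n, f (t • z) ∂m) U (𝓝 (∫ w, f w ∂(μ : Measure Z))) := by
  have hmeas : Measurable fun t : G => t • z :=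
    (continuous_id.smul continuous_const).measurable
  classical
  let emp : ℕ → ProbabilityMeasure Z := fun n =>
    if h : IsProbabilityMeasure (avgMeasure m (F n)) then
      ⟨(avgMeasure m (F n)).map (fun t => t • z),
        Measure.isProbabilityMeasure_map hmeas.aemeasurable⟩
    else ⟨Measure.dirac z, inferInstance⟩
  have hemp : ∀ f : Z → ℝ, Continuous f → ∀ᶠ n in atTop,
      ∫ w, f w ∂(emp n : Measure Z) = ⨍ t in F n, f (t • z) ∂m := by
    intro f hf
    filter_upwards [hF.eventually_isProbabilityMeasure] with n hn
    have hval : emp n = ⟨(avgMeasure m (F n)).map (fun t => t • z),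
        Measure.isProbabilityMeasure_map hmeas.aemeasurable⟩ := dif_pos hn
    rw [hval, setAverage_eq_integral_avgMeasure]
    exact integral_map hmeas.aemeasurable hf.aestronglyMeasurable
  -- Compactness of the space of probability measures on `Z`.
  obtain ⟨μ, hμ⟩ : ∃ μ, Tendsto emp U (𝓝 μ) := ⟨(U.map emp).lim, (U.map emp).le_nhds_lim⟩
  have hlim : ∀ f : Z → ℝ, Continuous f →
      Tendsto (fun n => ⨍ t in F n, f (t • z) ∂m) U (𝓝 (∫ w, f w ∂(μ : Measure Z))) := by
    intro f hf
    have := ProbabilityMeasure.tendsto_iff_forall_integral_tendsto.1 hμ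
      (BoundedContinuousFunction.mkOfCompact ⟨f, hf⟩)
    exact this.congr' (hU (hemp f hf))
  refine ⟨μ, ⟨smulInvariantMeasure_of_integral_eq fun g f hf => ?_, ?_⟩, hlim⟩
  · obtain ⟨M, -, hM⟩ := exists_abs_le_of_continuous hf
    have h₁ := hlim (fun w => f (g • w)) (hf.comp (continuous_const_smul g))
    have h₂ := (hF.tendsto_setAverage_translate_sub (stronglyMeasurable_orbit hf z)
      (fun t => hM _) g).mono_left hU
    simp only [mul_smul] at h₂
    exact sub_eq_zero.1 (tendsto_nhds_unique (h₁.sub (hlim f hf)) h₂)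
  -- The distance to the orbit closure vanishes along the orbit, so its limit integral is zero.
  · have hne : (orbitClosure G z).Nonempty := ⟨z, subset_closure (MulAction.mem_orbit_self z)⟩
    have hcont : Continuous fun w => Metric.infDist w (orbitClosure G z) :=
      Metric.continuous_infDist_pt _
    have h0 : ∫ w, Metric.infDist w (orbitClosure G z) ∂(μ : Measure Z) = 0 := by
      refine tendsto_nhds_unique (hlim _ hcont) (tendsto_const_nhds.congr fun n => ?_)
      have : ∀ t : G, Metric.infDist (t • z) (orbitClosure G z) = 0 := fun t =>
        Metric.infDist_zero_of_mem (subset_closure (MulAction.mem_orbit z t))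
      simp [this]
    obtain ⟨M, -, hM⟩ := exists_abs_le_of_continuous hcont
    rw [integral_eq_zero_iff_of_nonneg (fun _ => Metric.infDist_nonneg)
      (Integrable.of_bound hcont.aestronglyMeasurable M (Eventually.of_forall hM))] at h0
    refine (prob_compl_eq_zero_iff isClosed_closure.measurableSet).1 ?_
    exact measure_mono_null (fun w hw hw' => hw
      ((isClosed_closure.mem_iff_infDist_zero hne).2 hw')) h0

/-- In a uniquely ergodic orbit closure, the averages of every continuous function along every
Følner sequence converge to its integral. -/
theorem IsFolnerSequence.tendsto_setAverage (hF : IsFolnerSequence m F) {z : Z}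
    (hz : IsUniquelyErgodic G (orbitClosure G z)) {μ : ProbabilityMeasure Z}
    (hμ : IsInvariantOn G (orbitClosure G z) μ) {f : Z → ℝ} (hf : Continuous f) :
    Tendsto (fun n => ⨍ t in F n, f (t • z) ∂m) atTop (𝓝 (∫ w, f w ∂(μ : Measure Z))) := by
  refine (tendsto_iff_ultrafilter _ _ _).2 fun U hU => ?_
  obtain ⟨ν, hν, hlim⟩ := hF.exists_tendsto_setAverage z U hU
  rw [hz.unique hμ hν]
  exact hlim f hf

theorem exists_isInvariantOn_orbitClosure (hG : IsAmenable m) (z : Z) :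
    ∃ μ : ProbabilityMeasure Z, IsInvariantOn G (orbitClosure G z) μ := by
  obtain ⟨F, hF⟩ := hG
  obtain ⟨μ, hμ, -⟩ := hF.exists_tendsto_setAverage z (Ultrafilter.of atTop) (Ultrafilter.of_le _)
  exact ⟨μ, hμ⟩

end Empirical

/-! ### Invariant measures and invariant kernels -/

section InvariantMeasures

variable {G : Type*} [Group G] {Z : Type*} [TopologicalSpace Z] [MeasurableSpace Z] [MulAction G Z]

omit [TopologicalSpace Z] in
theorem IsInvariantOn.ae_mem {A : Set Z} {μ : ProbabilityMeasure Z} (h : IsInvariantOn G A μ)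
    (hA : MeasurableSet A) : ∀ᵐ w ∂(μ : Measure Z), w ∈ A :=
  (prob_compl_eq_zero_iff hA).2 h.carried

theorem isInvariantOn_orbitMeasure (h : IsPointwiseUniquelyErgodic G Z) (z : Z) :
    IsInvariantOn G (orbitClosure G z) (orbitMeasure h z) :=
  (h z).exists.choose_spec

end InvariantMeasures

section InvariantKernels

variable {G : Type*} [Group G] [TopologicalSpace G] {Z : Type*} [MetricSpace Z] [CompactSpace Z]
  [MeasurableSpace Z] [BorelSpace Z] [MulAction G Z] [ContinuousSMul G Z]

theorem continuous_integral_left {Φ : Z × Z → ℝ} (hΦ : Continuous Φ) (ν : Measure Z)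
    [IsFiniteMeasure ν] : Continuous fun w => ∫ w', Φ (w, w') ∂ν := by
  simpa using continuous_parametric_integral_of_continuous (μ := ν)
    (f := fun w w' => Φ (w, w')) hΦ isCompact_univ

/-- The partial integral of an invariant kernel against an invariant measure is constant on orbit
closures. -/
theorem integral_left_eq_of_mem_orbitClosure {Φ : Z × Z → ℝ} (hΦ : Continuous Φ)
    (hinv : ∀ (g : G) p, Φ (g • p) = Φ p) (ν : Measure Z) [IsFiniteMeasure ν]
    [SMulInvariantMeasure G Z ν] {z w : Z} (hw : w ∈ orbitClosure G z) :
    ∫ w', Φ (w, w') ∂ν = ∫ w', Φ (z, w') ∂ν := by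
  have hclosed : IsClosed {w | ∫ w', Φ (w, w') ∂ν = ∫ w', Φ (z, w') ∂ν} :=
    isClosed_eq (continuous_integral_left hΦ ν) continuous_const
  refine closure_minimal ?_ hclosed hw
  rintro _ ⟨g, rfl⟩
  change ∫ w', Φ (g • z, w') ∂ν = _
  rw [← integral_smul_eq_of_smulInvariant g (fun w' => Φ (g • z, w'))]
  exact integral_congr_ae (Eventually.of_forall fun w' => hinv g (z, w'))

theorem smulInvariantMeasure_prod (ν₁ ν₂ : Measure Z) [IsFiniteMeasure ν₁] [IsFiniteMeasure ν₂]
    [SMulInvariantMeasure G Z ν₁] [SMulInvariantMeasure G Z ν₂] :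
    SMulInvariantMeasure G (Z × Z) (ν₁.prod ν₂) where
  measure_preimage_smul g _ hs :=
    ((measurePreserving_smul g ν₁).prod (measurePreserving_smul g ν₂)).measure_preimage
      hs.nullMeasurableSet

end InvariantKernels

/-! ### Mean equicontinuity implies unique ergodicity and continuity -/

variable {G : Type*} [Group G] [TopologicalSpace G] [IsTopologicalGroup G] [MeasurableSpace G]
  [BorelSpace G] {Z : Type*} [MetricSpace Z] [CompactSpace Z] [MeasurableSpace Z] [BorelSpace Z]
  [MulAction G Z] [ContinuousSMul G Z] {m : Measure G} [m.IsHaarMeasure]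

omit [IsTopologicalGroup G] [m.IsHaarMeasure] in
/-- If `Φ` is invariant and vanishes where the Weyl pseudometric is at least `r`, then the mean
distance with respect to the density `Φ` is at most `r`. -/
theorem integral_dist_mul_le (hG : IsAmenable m) {P : Measure (Z × Z)} [IsProbabilityMeasure P]
    [SMulInvariantMeasure G (Z × Z) P] {Φ : Z × Z → ℝ} (hΦ : Continuous Φ) (hΦ0 : ∀ p, 0 ≤ Φ p)
    (hinv : ∀ (g : G) p, Φ (g • p) = Φ p) {r : ℝ}
    (hr : ∀ p : Z × Z, r ≤ weylDist m p.1 p.2 → Φ p = 0) :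
    ∫ p, dist p.1 p.2 * Φ p ∂P ≤ r * ∫ p, Φ p ∂P := by
  obtain ⟨F, hF⟩ := hG
  obtain ⟨B, hB0, hB⟩ := exists_abs_le_of_continuous hΦ
  set M := Metric.diam (Set.univ : Set Z) with hM
  have hΦint : Integrable Φ P :=
    Integrable.of_bound hΦ.aestronglyMeasurable B (Eventually.of_forall hB)
  let a : ℕ → Z × Z → ℝ := fun n p => ⨍ t in F n, dist (t • p.1) (t • p.2) ∂m
  have hjoint : StronglyMeasurable
      (Function.uncurry fun (p : Z × Z) (t : G) => dist (t • p.1) (t • p.2)) :=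
    stronglyMeasurable_uncurry_of_continuous_of_stronglyMeasurable
      (fun t => (continuous_fst.const_smul t).dist (continuous_snd.const_smul t))
      (fun p => stronglyMeasurable_dist_smul p.1 p.2)
  have ha_meas : ∀ n, StronglyMeasurable (a n) := fun n => by
    simp only [a, setAverage_eq_integral_avgMeasure]
    exact hjoint.integral_prod_right
  have ha : ∀ n p, a n p ∈ Set.Icc 0 M := fun n p => setAverage_dist_smul_mem_Icc (F n) p.1 p.2
  have haint : ∀ n, Integrable (fun p => a n p * Φ p) P := fun n => by
    refine Integrable.of_bound ((ha_meas n).aestronglyMeasurable.mul hΦ.aestronglyMeasurable)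
      (M * B) (Eventually.of_forall fun p => ?_)
    rw [Real.norm_eq_abs, abs_mul, abs_of_nonneg (ha n p).1]
    exact mul_le_mul (ha n p).2 (hB p) (abs_nonneg _) Metric.diam_nonneg
  -- Invariance of `P` and `Φ` lets `dist` be translated by any `t`; averaging over `t ∈ F n` and
  -- Fubini replace it by `a n`.
  have hfub : ∀ᶠ n in atTop, ∫ p, dist p.1 p.2 * Φ p ∂P = ∫ p, a n p * Φ p ∂P := by
    filter_upwards [hF.eventually_isProbabilityMeasure] with n hn
    have hconst : ∀ t : G, ∫ p, dist (t • p.1) (t • p.2) * Φ p ∂P =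
        ∫ p, dist p.1 p.2 * Φ p ∂P := fun t => by
      rw [← integral_smul_eq_of_smulInvariant t (fun p : Z × Z => dist p.1 p.2 * Φ p)]
      simp [hinv]
    have hswap := integral_integral_swap (μ := P) (ν := avgMeasure m (F n))
      (f := fun p t => dist (t • p.1) (t • p.2) * Φ p) (by
        refine Integrable.of_bound (hjoint.mul
          (hΦ.stronglyMeasurable.comp_measurable measurable_fst)).aestronglyMeasurable
          (M * B) (Eventually.of_forall fun q => ?_)
        simp only [Function.uncurry, Real.norm_eq_abs, abs_mul]
        rw [abs_of_nonneg dist_nonneg]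
        exact mul_le_mul (dist_le_diam_univ _ _) (hB _) (abs_nonneg _) Metric.diam_nonneg)
    simp only [hconst, integral_mul_const, integral_const, probReal_univ, one_smul] at hswap
    rw [← hswap]
    simp only [a, setAverage_eq_integral_avgMeasure]
  -- The excess over `r` dies pointwise: where D < `r` the averages are eventually below `r`, and
  -- elsewhere `Φ` vanishes.
  have hlim : Tendsto (fun n => ∫ p, max (a n p - r) 0 * Φ p ∂P) atTop (𝓝 (∫ _, (0 : ℝ) ∂P)) := by
    refine tendsto_integral_of_dominated_convergence (fun _ => (M + |r|) * B) (fun n => ?_)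
      (integrable_const _) (fun n => Eventually.of_forall fun p => ?_)
      (Eventually.of_forall fun p => ?_)
    · exact ((((ha_meas n).measurable.sub_const r).max measurable_const).mul
        hΦ.measurable).aestronglyMeasurable
    · rw [Real.norm_eq_abs, abs_mul, abs_of_nonneg (le_max_right _ _)]
      refine mul_le_mul (max_le ?_ ?_) (hB p) (abs_nonneg _) ?_
      · linarith [(ha n p).2, neg_abs_le r]
      · linarith [abs_nonneg r, (ha n p).1, (ha n p).2]
      · linarith [abs_nonneg r, (ha n p).1, (ha n p).2]
    · rcases lt_or_ge (weylDist m p.1 p.2) r with h | h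
      · refine tendsto_const_nhds.congr' ?_
        filter_upwards [eventually_setAverage_dist_lt hF h] with n hn
        rw [max_eq_right (by simp only [a]; linarith), zero_mul]
      · simp [hr p h]
  rw [integral_zero] at hlim
  have hlim' := hlim.const_add (r * ∫ p, Φ p ∂P)
  rw [add_zero] at hlim'
  refine ge_of_tendsto hlim' ?_
  filter_upwards [hfub] with n hn
  have hmaxint : Integrable (fun p => max (a n p - r) 0 * Φ p) P := by
    have h := ((haint n).sub (hΦint.const_mul r)).pos_part
    refine h.congr (Eventually.of_forall fun p => ?_)
    simp only [Pi.sub_apply]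
    rw [← sub_mul, max_mul_of_nonneg _ _ (hΦ0 p), zero_mul]
  rw [hn, ← integral_const_mul, ← integral_add (hΦint.const_mul r) hmaxint]
  refine integral_mono (haint n) ((hΦint.const_mul r).add hmaxint) fun p => ?_
  have := mul_le_mul_of_nonneg_right (le_max_left (a n p - r) 0) (hΦ0 p)
  simp only
  linarith

/-- The density `Φ` turns `ν₁ × ν₂` into an unnormalised coupling of total mass `c`, whose mean
distance is at most `r * c`; dividing by `c` gives the bound. -/
theorem IsMeanEquicontinuous.abs_integral_sub_integral_le [LocallyCompactSpace G]
    [SigmaCompactSpace G] [m.Regular] (hG : IsAmenable m)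
    (h : IsMeanEquicontinuous Z m) {z : Z} {ν₁ ν₂ : ProbabilityMeasure Z}
    (h₁ : IsInvariantOn G (orbitClosure G z) ν₁) (h₂ : IsInvariantOn G (orbitClosure G z) ν₂)
    {f : Z → ℝ} (hf : Continuous f) {ε C r : ℝ} (hr : 0 < r) (hC0 : 0 ≤ C)
    (hC : ∀ a b, |f a - f b| ≤ ε + C * dist a b) :
    |∫ w, f w ∂(ν₁ : Measure Z) - ∫ w, f w ∂(ν₂ : Measure Z)| ≤ ε + C * r := by
  have := h₁.invariant
  have := h₂.invariant
  have := smulInvariantMeasure_prod (G := G) (ν₁ : Measure Z) (ν₂ : Measure Z)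
  set P := (ν₁ : Measure Z).prod (ν₂ : Measure Z) with hP
  have hK : MeasurableSet (orbitClosure G z) := isClosed_closure.measurableSet
  let Φ : Z × Z → ℝ := fun p => max (r - weylDist m p.1 p.2) 0
  have hΦ : Continuous Φ := (continuous_const.sub (h.continuous_weylDist hG)).max continuous_const
  have hΦ0 : ∀ p, 0 ≤ Φ p := fun p => le_max_right _ _
  have hinv : ∀ (g : G) p, Φ (g • p) = Φ p := fun g p => by
    simp only [Φ, Prod.smul_fst, Prod.smul_snd, weylDist_smul_smul hG]
  have hΦr : ∀ p : Z × Z, r ≤ weylDist m p.1 p.2 → Φ p = 0 := fun p hp =>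
    max_eq_right (by linarith)
  have hΦcomm : ∀ w w', Φ (w, w') = Φ (w', w) := fun w w' => by
    simp only [Φ, weylDist_comm w w']
  have hint : ∀ ψ : Z × Z → ℝ, Continuous ψ → Integrable ψ P := fun ψ hψ => by
    obtain ⟨B, -, hB⟩ := exists_abs_le_of_continuous hψ
    exact Integrable.of_bound hψ.aestronglyMeasurable B (Eventually.of_forall hB)
  -- The first marginal of `Φ · P` is a multiple of `ν₁`, because the inner integral is constant on
  -- the orbit closure. `key₂` is the same for `ν₂`.
  have key₁ : ∀ φ : Z → ℝ, Continuous φ → ∫ p, φ p.1 * Φ p ∂P =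
      (∫ w, φ w ∂(ν₁ : Measure Z)) * ∫ w', Φ (z, w') ∂(ν₂ : Measure Z) := fun φ hφ => by
    rw [integral_prod _ (hint (fun p => φ p.1 * Φ p) ((hφ.comp continuous_fst).mul hΦ)),
      ← integral_mul_const]
    refine integral_congr_ae ?_
    filter_upwards [h₁.ae_mem hK] with w hw
    rw [integral_const_mul, integral_left_eq_of_mem_orbitClosure hΦ hinv _ hw]
  have key₂ : ∀ φ : Z → ℝ, Continuous φ → ∫ p, φ p.2 * Φ p ∂P =
      (∫ w, φ w ∂(ν₂ : Measure Z)) * ∫ w', Φ (z, w') ∂(ν₁ : Measure Z) := fun φ hφ => by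
    rw [integral_prod_symm _ (hint (fun p => φ p.2 * Φ p) ((hφ.comp continuous_snd).mul hΦ)),
      ← integral_mul_const]
    refine integral_congr_ae ?_
    filter_upwards [h₂.ae_mem hK] with w hw
    rw [integral_const_mul, ← integral_left_eq_of_mem_orbitClosure hΦ hinv _ hw]
    simp only [hΦcomm w]
  set c := ∫ w', Φ (z, w') ∂(ν₂ : Measure Z) with hc
  have hcP : ∫ p, Φ p ∂P = c := by simpa using key₁ (fun _ => 1) continuous_const
  have hc' : ∫ w', Φ (z, w') ∂(ν₁ : Measure Z) = c := by
    rw [← hcP]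
    simpa using (key₂ (fun _ => 1) continuous_const).symm
  -- Take `w` in the orbit closure all of whose neighbourhoods there have positive `ν₂`-mass. Since
  -- `Φ (w, w) = r > 0`, the partial integral at `w`, which equals `c`, is positive.
  have hcpos : 0 < c := by
    obtain ⟨w, hwK, hw⟩ := exists_mem_forall_mem_nhdsWithin_pos_measure
      (μ := (ν₂ : Measure Z)) (s := orbitClosure G z) (by simp [h₂.carried])
    have hΦw : Continuous fun w' => Φ (w, w') := hΦ.comp (Continuous.prodMk_right w)
    have hpos : 0 < Φ (w, w) := by
      simp only [Φ, weylDist_self hG, sub_zero]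
      exact lt_max_of_lt_left hr
    rw [hc, ← integral_left_eq_of_mem_orbitClosure hΦ hinv _ hwK,
      integral_pos_iff_support_of_nonneg (fun w' => hΦ0 _)]
    · exact hw _ (mem_nhdsWithin_of_mem_nhds
        (hΦw.isOpen_support.mem_nhds hpos.ne'))
    · obtain ⟨B, -, hB⟩ := exists_abs_le_of_continuous hΦw
      exact Integrable.of_bound hΦw.aestronglyMeasurable B (Eventually.of_forall hB)
  have hdist := integral_dist_mul_le hG hΦ hΦ0 hinv hΦr (P := P)
  have hdiff : (∫ w, f w ∂(ν₁ : Measure Z) - ∫ w, f w ∂(ν₂ : Measure Z)) * c =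
      ∫ p, (f p.1 - f p.2) * Φ p ∂P := by
    have h1 := key₁ f hf
    have h2 := key₂ f hf
    rw [hc'] at h2
    rw [sub_mul, ← h1, ← h2, ← integral_sub
      (hint (fun p => f p.1 * Φ p) ((hf.comp continuous_fst).mul hΦ))
      (hint (fun p => f p.2 * Φ p) ((hf.comp continuous_snd).mul hΦ))]
    simp only [sub_mul]
  have hbound : |∫ p, (f p.1 - f p.2) * Φ p ∂P| ≤ ∫ p, (ε * Φ p + C * (dist p.1 p.2 * Φ p)) ∂P := by
    refine norm_integral_le_of_norm_le (f := fun p : Z × Z => (f p.1 - f p.2) * Φ p)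
      (hint (fun p => ε * Φ p + C * (dist p.1 p.2 * Φ p)) (by fun_prop))
      (Eventually.of_forall fun p => ?_)
    rw [Real.norm_eq_abs, abs_mul, abs_of_nonneg (hΦ0 p)]
    have := mul_le_mul_of_nonneg_right (hC p.1 p.2) (hΦ0 p)
    linarith
  rw [integral_add (hint (fun p => ε * Φ p) (by fun_prop))
    (hint (fun p => C * (dist p.1 p.2 * Φ p)) (by fun_prop)), integral_const_mul,
    integral_const_mul, hcP, ← hdiff, abs_mul, abs_of_pos hcpos] at hbound
  rw [hcP] at hdist
  refine le_of_mul_le_mul_right (hbound.trans ?_) hcpos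
  have := mul_le_mul_of_nonneg_left hdist hC0
  linarith

theorem IsMeanEquicontinuous.isPointwiseUniquelyErgodic [LocallyCompactSpace G]
    [SigmaCompactSpace G] [m.Regular] (hG : IsAmenable m)
    (h : IsMeanEquicontinuous Z m) : IsPointwiseUniquelyErgodic G Z := by
  intro z
  obtain ⟨μ, hμ⟩ := exists_isInvariantOn_orbitClosure hG z
  refine ⟨μ, hμ, fun ν hν => Subtype.ext ?_⟩
  refine ext_of_forall_integral_eq_of_IsFiniteMeasure (μ := (ν : Measure Z))
    (ν := (μ : Measure Z)) fun f => ?_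
  refine eq_of_abs_sub_nonpos (le_of_forall_pos_le_add fun ε hε => ?_)
  obtain ⟨C, hC0, hC⟩ := exists_abs_sub_le_add_mul_dist f.continuous (half_pos hε)
  -- Dividing by `C + 1` rather than `C` covers `C = 0`.
  refine (h.abs_integral_sub_integral_le hG hν hμ f.continuous
    (r := ε / 2 / (C + 1)) (by positivity) hC0 hC).trans ?_
  have : C * (ε / 2 / (C + 1)) ≤ ε / 2 := by
    rw [mul_div_assoc', div_le_iff₀ (by positivity)]
    nlinarith
  linarith

/-- Both integrals are limits of averages along one Følner sequence, so they can be compared under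
the average at each `t`. -/
theorem abs_integral_orbitMeasure_sub_le (hG : IsAmenable m) (h : IsPointwiseUniquelyErgodic G Z)
    {f : Z → ℝ} (hf : Continuous f) {ε C : ℝ} (hC0 : 0 ≤ C)
    (hC : ∀ a b, |f a - f b| ≤ ε + C * dist a b) (x y : Z) :
    |∫ w, f w ∂(orbitMeasure h x : Measure Z) - ∫ w, f w ∂(orbitMeasure h y : Measure Z)| ≤
      ε + C * weylDist m x y := by
  obtain ⟨F, hF⟩ := id hG
  have hx := hF.tendsto_setAverage (h x) (isInvariantOn_orbitMeasure h x) hf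
  have hy := hF.tendsto_setAverage (h y) (isInvariantOn_orbitMeasure h y) hf
  refine le_of_forall_pos_le_add fun η hη => le_of_tendsto (hx.sub hy).abs ?_
  have hlt : weylDist m x y < weylDist m x y + η / (C + 1) := by
    have : 0 < η / (C + 1) := by positivity
    linarith
  filter_upwards [hF.eventually_isProbabilityMeasure, eventually_setAverage_dist_lt hF hlt]
    with n hn hlt
  simp only [setAverage_eq_integral_avgMeasure] at hlt ⊢
  rw [← integral_sub (integrable_orbit hf _ _) (integrable_orbit hf _ _)]
  have hle : |∫ t, (f (t • x) - f (t • y)) ∂avgMeasure m (F n)| ≤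
      ∫ t, (ε + C * dist (t • x) (t • y)) ∂avgMeasure m (F n) :=
    norm_integral_le_of_norm_le (f := fun t => f (t • x) - f (t • y))
      ((integrable_const ε).add ((integrable_dist_smul x y _).const_mul C))
      (Eventually.of_forall fun t => hC _ _)
  rw [integral_add (integrable_const ε) ((integrable_dist_smul x y _).const_mul C),
    integral_const, integral_const_mul, probReal_univ, one_smul] at hle
  have h1 := mul_le_mul_of_nonneg_left hlt.le hC0
  have h2 : C * (η / (C + 1)) ≤ η := by
    rw [mul_div_assoc', div_le_iff₀ (by positivity)]
    nlinarith
  linarith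

theorem IsMeanEquicontinuous.continuous_orbitMeasure (hG : IsAmenable m)
    (hZ : IsMeanEquicontinuous Z m) (h : IsPointwiseUniquelyErgodic G Z) :
    Continuous (orbitMeasure h) := by
  refine continuous_iff_continuousAt.2 fun x =>
    ProbabilityMeasure.tendsto_iff_forall_integral_tendsto.2 fun f => ?_
  refine Metric.tendsto_nhds.2 fun ε hε => ?_
  obtain ⟨C, hC0, hC⟩ := exists_abs_sub_le_add_mul_dist f.continuous (half_pos hε)
  obtain ⟨δ, hδ, hδ'⟩ := hZ (ε / 2 / (C + 1)) (by positivity)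
  filter_upwards [Metric.ball_mem_nhds x hδ] with y hy
  rw [Real.dist_eq]
  refine (abs_integral_orbitMeasure_sub_le hG h f.continuous hC0 hC y x).trans_lt ?_
  have h1 : (C + 1) * weylDist m y x < ε / 2 := by
    rw [mul_comm, ← lt_div_iff₀ (by positivity)]
    exact hδ' y x hy
  have h2 := weylDist_nonneg hG y x
  linarith

/-! ### The converse direction -/

/-- Since `dist` is continuous on `X × X`, its averages converge to this integral along every Følner
sequence: the upper limit is a limit and the supremum is over a constant. -/
theorem weylDist_eq_integral_dist {X : Type*} [MetricSpace X] [CompactSpace X] [MeasurableSpace X]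
    [BorelSpace X] [MulAction G X] [ContinuousSMul G X] (hG : IsAmenable m)
    (h : IsPointwiseUniquelyErgodic G (X × X)) (x y : X) :
    weylDist m x y = ∫ p, dist p.1 p.2 ∂(orbitMeasure h (x, y) : Measure (X × X)) := by
  have hlim : ∀ F, IsFolnerSequence m F → besicovitchDist m F x y =
      ∫ p, dist p.1 p.2 ∂(orbitMeasure h (x, y) : Measure (X × X)) := fun F hF =>
    (hF.tendsto_setAverage (h (x, y)) (isInvariantOn_orbitMeasure h (x, y))
      continuous_dist).limsup_eq
  refine le_antisymm (weylDist_le hG fun F hF => (hlim F hF).le) ?_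
  obtain ⟨F, hF⟩ := hG
  exact (hlim F hF).symm.le.trans (besicovitchDist_le_weylDist hF x y)

theorem isMeanEquicontinuous_of_continuous_orbitMeasure {X : Type*} [MetricSpace X]
    [CompactSpace X] [MeasurableSpace X] [BorelSpace X] [MulAction G X] [ContinuousSMul G X]
    (hG : IsAmenable m) (h : IsPointwiseUniquelyErgodic G (X × X))
    (hcont : Continuous (orbitMeasure h)) : IsMeanEquicontinuous X m := by
  have hD : Continuous fun p : X × X => weylDist m p.1 p.2 := by
    simp only [weylDist_eq_integral_dist hG h]
    refine continuous_iff_continuousAt.2 fun p => ?_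
    exact ProbabilityMeasure.tendsto_iff_forall_integral_tendsto.1 (hcont.tendsto p)
      (BoundedContinuousFunction.mkOfCompact ⟨fun q : X × X => dist q.1 q.2, continuous_dist⟩)
  intro ε hε
  obtain ⟨δ, hδ, hδ'⟩ :=
    Metric.uniformContinuous_iff.1 (CompactSpace.uniformContinuous_of_continuous hD) ε hε
  refine ⟨δ, hδ, fun x y hxy => ?_⟩
  -- Comparison with the diagonal point `(y, y)`, where D is zero.
  have hdist : dist (x, y) (y, y) < δ := by simpa [Prod.dist_eq, hδ] using hxy
  have := hδ' hdist
  simp only [weylDist_self hG, Real.dist_eq, sub_zero] at this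
  exact (le_abs_self _).trans_lt this

end MeanEquicontinuity

end

theorem theorem1p2
    {G : Type*} [Group G] [TopologicalSpace G] [IsTopologicalGroup G]
    [LocallyCompactSpace G] [SigmaCompactSpace G] [MeasurableSpace G] [BorelSpace G]
    (m : MeasureTheory.Measure G) [m.IsHaarMeasure] [m.Regular]
    (hG : MeanEquicontinuity.IsAmenable m)
    {X : Type*} [MetricSpace X] [CompactSpace X] [MeasurableSpace X] [BorelSpace X]
    [MulAction G X] [ContinuousSMul G X] :
    MeanEquicontinuity.IsMeanEquicontinuous X m ↔
      ∃ h : MeanEquicontinuity.IsPointwiseUniquelyErgodic G (X × X),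
        Continuous (MeanEquicontinuity.orbitMeasure h) := by
  refine ⟨fun h => ?_, fun ⟨h, hcont⟩ =>
    MeanEquicontinuity.isMeanEquicontinuous_of_continuous_orbitMeasure hG h hcont⟩
  have hprod := h.prod hG
  exact ⟨hprod.isPointwiseUniquelyErgodic hG, hprod.continuous_orbitMeasure hG _⟩
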